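/- Notation. A forest is a sequence \(F=(F_i)_{i\ge 0}\) of finite binary trees, all but finitely many of them trivial (a single node). The leaves of \(F\) are numbered \(0,1,2,\dots\) from left to right, the leaves of \(F_i\) coming before those of \(F_j\) when \(i<j\). Forests form a monoid \(\mathcal F\): the product \(FG\) is obtained by identifying, for each \(i\), the root of \(G_i\) with the \(i\)-th leaf of \(F\); the identity is the forest of trivial trees. Let \(\lambda_m\in\mathcal F\) be the forest whose only non-trivial tree is the \(m\)-th one, consisting of a single caret; the \(\lambda_m\), \(m\ge0\), generate \(\mathcal F\). Let \(B_\infty\) be the infinite braid group, with generators \(\sigma_0,\sigma_1,\dots\) and relations \(\sigma_m\sigma_n=\sigma_n\sigma_m\) for \(|m-n|\ge 2\) and \(\sigma_m\sigma_{m+1}\sigma_m=\sigma_{m+1}\sigma_m\sigma_{m+1}\) for \(m\ge0\). The Zappa-Szép product of \(\mathcal F\) and \(B_\infty\) is formed with the mutual actions \(B_\infty\times\mathcal F\to\mathcal F\), \((\sigma,u)\mapsto\sigma\cdot u\), and \(B_\infty\times\mathcal F\to B_\infty\), \((\sigma,u)\mapsto\sigma^u\), which are determined by the laws \[(\sigma\tau)\cdot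 u=\sigma\cdot(\tau\cdot u),\quad (\sigma\tau)^u=\sigma^{\tau\cdot u}\,\tau^u,\quad \sigma\cdot(uv)=(\sigma\cdot u)(\sigma^u\cdot v),\quad \sigma^{uv}=(\sigma^u)^v,\] \[\sigma^1=\sigma,\quad 1\cdot u=u,\quad \sigma\cdot 1=1,\quad 1^u=1,\] and by the following values on generators, where \(\epsilon=\pm1\) and \(s_q\) is the transposition of \(q\) and \(q+1\): \[\sigma_q^{\epsilon}\cdot\lambda_m=\lambda_{s_q(m)},\qquad (\sigma_q^{\epsilon})^{\lambda_m}=\begin{cases}\sigma_{q+1}^{\epsilon}, & m<q,\\ \sigma_q^{\epsilon}\sigma_{q+1}^{\epsilon}, & m=q,\\ \sigma_{q+1}^{\epsilon}\sigma_q^{\epsilon}, & m=q+1,\\ \sigma_q^{\epsilon}, & m>q+1.\end{cases}\] Lemma 4.13 (StrCoCon). The family of functions \((\sigma,u)\mapsto\sigma^u\) from \(B_\infty\times\mathcal F\) to \(B_\infty\) is a strongly coconfluent family of injections. That is: (1) for all \(u\in\mathcal F\) and \(\sigma,\tau\in B_\infty\), if \(\sigma^u=\tau^u\) then \(\sigma=\tau\);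 (2) \(\sigma^{uv}=(\sigma^u)^v\) for all \(\sigma\in B_\infty\) and \(u,v\in\mathcal F\), and whenever \(\sigma,\tau\in B_\infty\) and \(u,v\in\mathcal F\) are such that \(\sigma^u=\tau^v\) and \(u,v\) have a common left multiple (there are \(a,b\in\mathcal F\) with \(au=bv\)), there are \(\beta\in B_\infty\) and \(p,q\in\mathcal F\) with \(\sigma=\beta^p\), \(\tau=\beta^q\) and \(pu=qv\). -/

import Mathlib

/-! ## General notions: mutual actions, injective and strongly coconfluent families -/

/-- Mutual actions between monoids `U` and `A`: functions `(α, u) ↦ α ^ u` (`pow`) and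
`(α, u) ↦ α · u` (`dot`) with the laws that make
`(u, α) (v, β) = (u (α · v), α ^ v β)` the multiplication of a monoid on `U × A`,
the Zappa-Szép product of `U` and `A`. -/
structure ZappaSzepActions (U A : Type*) [Monoid U] [Monoid A] where
  /-- `α ^ u` -/
  pow : A → U → A
  /-- `α · u` -/
  dot : A → U → U
  mul_dot : ∀ (α β : A) (u : U), dot (α * β) u = dot α (dot β u)
  mul_pow : ∀ (α β : A) (u : U), pow (α * β) u = pow α (dot β u) * pow β u
  dot_mul : ∀ (α : A) (u v : U), dot α (u * v) = dot α u * dot (pow α u) v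
  pow_mul : ∀ (α : A) (u v : U), pow α (u * v) = pow (pow α u) v
  pow_one : ∀ α : A, pow α 1 = α
  one_dot : ∀ u : U, dot 1 u = u
  dot_one : ∀ α : A, dot α 1 = 1
  one_pow : ∀ u : U, pow 1 u = 1

/-- The family `α ↦ α ^ u`, indexed by `u : U`, is an injective family:
`α ^ u = β ^ u` always implies `α = β`. -/
def IsInjectiveFamily {A U : Type*} (pow : A → U → A) : Prop :=
  ∀ (u : U) (α β : A), pow α u = pow β u → α = β

/-- `u` and `v` have a common left multiple. -/
def HasCommonLeftMultiple {U : Type*} [Mul U] (u v : U) : Prop :=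
  ∃ a b : U, a * u = b * v

/-- The family `α ↦ α ^ u` satisfies `α ^ (u v) = (α ^ u) ^ v` and is strongly coconfluent:
whenever `α ^ u = β ^ v` and `u`, `v` have a common left multiple, there are
`γ`, `p`, `q` with `α = γ ^ p`, `β = γ ^ q` and `p u = q v`. -/
def IsStronglyCoconfluent {A U : Type*} [Mul U] (pow : A → U → A) : Prop :=
  (∀ (α : A) (u v : U), pow α (u * v) = pow (pow α u) v) ∧
  ∀ (α β : A) (u v : U), pow α u = pow β v → HasCommonLeftMultiple u v →
    ∃ (γ : A) (p q : U), α = pow γ p ∧ β = pow γ q ∧ p * u = q * v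

/-! ## The monoid of forests -/

/-- Finite binary trees; `BinaryTree.nil` is the trivial tree (one node). -/
abbrev BTree : Type := BinaryTree Unit

namespace BTree

/-- The tree obtained from `t` by hanging the tree `g j` from the `j`-th leaf of `t`,
the leaves of `t` being numbered `0, 1, …` from left to right. -/
def graft : BTree → (ℕ → BTree) → BTree
  | .nil, g => g 0
  | .node _ l r, g => .node () (graft l g) (graft r fun j => g (l.numLeaves + j))

theorem graft_congr (t : BTree) (g h : ℕ → BTree) (e : ∀ j < t.numLeaves, g j = h j) :
    graft t g = graft t h := by
  induction t generalizing g h with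
  | nil => exact e 0 (by simp)
  | node a l r ihl ihr =>
    simp only [graft]
    rw [ihl g h (fun j hj => e j (by simp; omega)),
      ihr _ _ (fun j hj => e _ (by simp; omega))]

theorem graft_nil (t : BTree) (g : ℕ → BTree) (e : ∀ j < t.numLeaves, g j = .nil) :
    graft t g = t := by
  induction t generalizing g with
  | nil => exact e 0 (by simp)
  | node a l r ihl ihr =>
    simp only [graft]
    rw [ihl g (fun j hj => e j (by simp; omega)), ihr _ (fun j hj => e _ (by simp; omega))]

theorem numLeaves_graft (t : BTree) (g : ℕ → BTree) :
    (graft t g).numLeaves = ∑ j ∈ Finset.range t.numLeaves, (g j).numLeaves := by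
  induction t generalizing g with
  | nil => simp [graft]
  | node a l r ihl ihr =>
    simp only [graft, BinaryTree.numLeaves, ihl, ihr, Finset.sum_range_add]

theorem graft_graft (t : BTree) (g h : ℕ → BTree) :
    graft (graft t g) h =
      graft t fun i => graft (g i) fun j =>
        h (∑ k ∈ Finset.range i, (g k).numLeaves + j) := by
  induction t generalizing g h with
  | nil => simp [graft]
  | node a l r ihl ihr =>
    simp only [graft, ihl, ihr, numLeaves_graft, Finset.sum_range_add, add_assoc]

end BTree

/-- A forest: a sequence of finite binary trees, all but finitely many of them trivial. -/
@[ext]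
structure Forest where
  /-- the `i`-th tree -/
  tree : ℕ → BTree
  finite_nontrivial : {i | tree i ≠ .nil}.Finite

namespace Forest

/-- The number of leaves in the trees number `0, …, i - 1`, which is the number of the first leaf
of the `i`-th tree when all the leaves of `F` are numbered `0, 1, 2, …` from left to right. -/
def start (F : Forest) (i : ℕ) : ℕ := ∑ k ∈ Finset.range i, (F.tree k).numLeaves

theorem start_zero (F : Forest) : F.start 0 = 0 := rfl

theorem start_succ (F : Forest) (i : ℕ) :
    F.start (i + 1) = F.start i + (F.tree i).numLeaves := Finset.sum_range_succ _ _

theorem le_start (F : Forest) (i : ℕ) : i ≤ F.start i := by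
  induction i with
  | zero => simp
  | succ n ih =>
    have := (F.tree n).numLeaves_pos
    rw [start_succ]; omega

theorem exists_bound (F : Forest) : ∃ N, ∀ i, N ≤ i → F.tree i = .nil := by
  obtain ⟨N, hN⟩ := F.finite_nontrivial.bddAbove
  refine ⟨N + 1, fun i hi => ?_⟩
  by_contra h
  have := hN h
  omega

theorem finite_of_bound {f : ℕ → BTree} (h : ∃ N, ∀ i, N ≤ i → f i = .nil) :
    {i | f i ≠ .nil}.Finite := by
  obtain ⟨N, hN⟩ := h
  refine (Set.finite_lt_nat N).subset fun i hi => ?_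
  by_contra h
  exact hi (hN i (not_lt.1 h))

instance : One Forest := ⟨⟨fun _ => .nil, by simp⟩⟩

/-- The product `F G`: the `i`-th root of `G` is identified with the `i`-th leaf of `F`. -/
instance : Mul Forest :=
  ⟨fun F G =>
    { tree := fun i => (F.tree i).graft fun j => G.tree (F.start i + j)
      finite_nontrivial := by
        obtain ⟨N, hN⟩ := F.exists_bound
        obtain ⟨M, hM⟩ := G.exists_bound
        refine finite_of_bound ⟨max N M, fun i hi => ?_⟩
        rw [BTree.graft_nil _ _ fun j _ => hM _ ?_, hN i (by omega)]
        have := F.le_start i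
        omega }⟩

theorem one_tree (i : ℕ) : (1 : Forest).tree i = .nil := rfl

theorem mul_tree (F G : Forest) (i : ℕ) :
    (F * G).tree i = (F.tree i).graft fun j => G.tree (F.start i + j) := rfl

theorem start_one (i : ℕ) : (1 : Forest).start i = i := by
  simp [start]

theorem start_mul (F G : Forest) (i : ℕ) : (F * G).start i = G.start (F.start i) := by
  induction i with
  | zero => rfl
  | succ n ih =>
    rw [start_succ, ih, start_succ, mul_tree, BTree.numLeaves_graft]
    simp only [start, Finset.sum_range_add]

instance : Monoid Forest where
  mul_assoc F G H := by
    ext1; funext i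
    simp only [mul_tree, BTree.graft_graft, start_mul]
    refine BTree.graft_congr _ _ _ fun j _ => ?_
    refine BTree.graft_congr _ _ _ fun k _ => ?_
    simp only [start, Finset.sum_range_add, add_assoc]
  one_mul F := by
    ext1; funext i
    simp [mul_tree, start_one, BTree.graft]
  mul_one F := by
    ext1; funext i
    exact BTree.graft_nil _ _ fun j _ => rfl

/-- The forest whose only non-trivial tree is `t`, in position `i`. -/
def single (i : ℕ) (t : BTree) : Forest where
  tree := fun k => if k = i then t else .nil
  finite_nontrivial := finite_of_bound ⟨i + 1, fun k hk => if_neg (by omega)⟩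

theorem single_tree (i : ℕ) (t : BTree) (k : ℕ) :
    (single i t).tree k = if k = i then t else .nil := rfl

theorem start_single (i : ℕ) (t : BTree) (k : ℕ) :
    (single i t).start k = if k ≤ i then k else k + t.numLeaves - 1 := by
  induction k with
  | zero => simp [start_zero]
  | succ k ih =>
    have := t.numLeaves_pos
    rw [start_succ, ih, single_tree]
    split_ifs <;> (try simp only [BinaryTree.numLeaves]) <;> omega

/-- The generator `lam i`: the forest with one caret, whose only non-trivial tree is the
`i`-th one. -/
def lam (i : ℕ) : Forest := single i (.node () .nil .nil)

theorem lam_tree (i k : ℕ) :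
    (lam i).tree k = if k = i then .node () .nil .nil else .nil := rfl

theorem start_lam (i k : ℕ) : (lam i).start k = if k ≤ i then k else k + 1 := by
  rw [lam, start_single]; simp

theorem lam_mul_lam {m q : ℕ} (h : m < q) : lam q * lam m = lam m * lam (q + 1) := by
  ext1; funext i
  simp only [mul_tree, lam_tree, start_lam]
  split_ifs <;> first | omega | (simp only [BTree.graft, BinaryTree.numLeaves]; grind)

/-- The product of generators `lam` spelled by a word. -/
def ofWord (w : List ℕ) : Forest := (w.map lam).prod

theorem ofWord_nil : ofWord [] = 1 := rfl

theorem ofWord_cons (i : ℕ) (w : List ℕ) : ofWord (i :: w) = lam i * ofWord w := by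
  simp [ofWord]

theorem ofWord_append (v w : List ℕ) : ofWord (v ++ w) = ofWord v * ofWord w := by
  simp [ofWord]

/-- A word in the generators for the forest whose only non-trivial tree is `t`, in position `p`. -/
def treeWord : BTree → ℕ → List ℕ
  | .nil, _ => []
  | .node _ l r, p => p :: (treeWord r (p + 1) ++ treeWord l p)

/-- A word in the generators for the trees number `0, …, n - 1` of `F`. -/
def wordTo (F : Forest) : ℕ → List ℕ
  | 0 => []
  | n + 1 => treeWord (F.tree n) n ++ wordTo F n

open Classical in
/-- A word in the generators representing the forest `F` (see `ofWord_word`). -/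
noncomputable def word (F : Forest) : List ℕ := F.wordTo (Nat.find F.exists_bound)

theorem wordTo_eq (F : Forest) {n k : ℕ} (h : ∀ i, n ≤ i → F.tree i = .nil) :
    F.wordTo (n + k) = F.wordTo n := by
  induction k with
  | zero => rfl
  | succ k ih => rw [← add_assoc, wordTo, h _ (by omega), treeWord, ih, List.nil_append]

theorem word_eq (F : Forest) {n : ℕ} (h : ∀ i, n ≤ i → F.tree i = .nil) :
    F.word = F.wordTo n := by
  classical
  obtain ⟨k, hk⟩ := Nat.exists_eq_add_of_le (Nat.find_min' F.exists_bound h)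
  rw [hk, wordTo_eq F (Nat.find_spec F.exists_bound), word]

theorem ofWord_treeWord (t : BTree) (p : ℕ) : ofWord (treeWord t p) = single p t := by
  induction t generalizing p with
  | nil =>
    ext1; funext i
    simp [treeWord, ofWord_nil, one_tree, single_tree]
  | node a l r ihl ihr =>
    rw [treeWord, ofWord_cons, ofWord_append, ihl, ihr]
    ext1; funext i
    simp only [mul_tree, single_tree, lam_tree, start_lam, start_single]
    by_cases h : i = p
    · subst h
      simp only [if_true, le_refl, BTree.graft, BinaryTree.numLeaves]
      simp only [if_true, add_zero, Nat.left_eq_add, one_ne_zero,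
        if_false, Nat.le_add_right, BTree.graft]
      rw [BTree.graft_nil r _ fun j _ => if_neg (by omega)]
    · simp only [if_neg h, BTree.graft]
      rw [BTree.graft_nil]
      · rw [if_neg]
        split_ifs <;> omega
      · intro j hj
        have := r.numLeaves_pos
        rw [if_neg]
        split_ifs at hj ⊢ <;> (try simp only [BinaryTree.numLeaves] at hj) <;> omega

theorem ofWord_wordTo_tree (F : Forest) (n : ℕ) (i : ℕ) :
    (ofWord (F.wordTo n)).tree i = if i < n then F.tree i else .nil := by
  induction n generalizing i with
  | zero => simp [wordTo, ofWord_nil, one_tree]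
  | succ n ih =>
    rw [wordTo, ofWord_append, ofWord_treeWord, mul_tree, single_tree]
    simp only [start_single, ih]
    have := (F.tree n).numLeaves_pos
    by_cases h : i = n
    · subst h
      rw [if_pos rfl, BTree.graft_nil, if_pos (by omega)]
      intro j _
      rw [if_neg]
      split_ifs <;> omega
    · rw [if_neg h]
      simp only [BTree.graft]
      by_cases h' : i < n
      · rw [if_pos (by omega : i ≤ n), add_zero, if_pos h', if_pos (by omega)]
      · rw [if_neg (by omega : ¬i ≤ n), if_neg (by omega), if_neg (by omega)]

theorem ofWord_word (F : Forest) : ofWord F.word = F := by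
  obtain ⟨N, hN⟩ := F.exists_bound
  ext1; funext i
  rw [word_eq F hN, ofWord_wordTo_tree]
  split_ifs with h
  · rfl
  · exact (hN i (not_lt.1 h)).symm

theorem word_one : (1 : Forest).word = [] :=
  word_eq 1 (n := 0) fun _ _ => rfl

/-- A relation between words that is an equivalence relation, is compatible with concatenation,
and contains the defining relations of the monoid of forests. -/
structure IsWordCongruence (R : List ℕ → List ℕ → Prop) : Prop where
  refl : ∀ w, R w w
  symm : ∀ {v w}, R v w → R w v
  trans : ∀ {u v w}, R u v → R v w → R u w
  append : ∀ {v v' w w'}, R v v' → R w w' → R (v ++ w) (v' ++ w')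
  rel : ∀ {m q}, m < q → R [q, m] [m, q + 1]

section Congruence

variable {R : List ℕ → List ℕ → Prop}

theorem IsWordCongruence.move_treeWord (hR : IsWordCongruence R) (t : BTree) {p q : ℕ}
    (h : p < q) :
    R (q :: treeWord t p) (treeWord t p ++ [q + t.numLeaves - 1]) := by
  induction t generalizing p q with
  | nil => exact hR.refl _
  | node a l r ihl ihr =>
    have hl := l.numLeaves_pos
    have hr := r.numLeaves_pos
    have h1 := hR.append (hR.rel h) (hR.refl (treeWord r (p + 1) ++ treeWord l p))
    have h2 := hR.append (hR.append (hR.refl [p]) (ihr (p := p + 1) (q := q + 1) (by omega)))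
      (hR.refl (treeWord l p))
    have h3 := hR.append (hR.refl (p :: treeWord r (p + 1)))
      (ihl (p := p) (q := q + 1 + r.numLeaves - 1) (by omega))
    have e : q + 1 + r.numLeaves - 1 + l.numLeaves - 1 =
      q + (l.numLeaves + r.numLeaves) - 1 := by omega
    rw [e] at h3
    simp only [treeWord, BinaryTree.numLeaves, List.cons_append, List.nil_append,
      List.append_assoc] at h1 h2 h3 ⊢
    exact hR.trans h1 (hR.trans h2 h3)

theorem IsWordCongruence.move_wordTo (hR : IsWordCongruence R) (F : Forest) {n q : ℕ}
    (h : n ≤ q) :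
    R (q :: F.wordTo n) (F.wordTo n ++ [q + F.start n - n]) := by
  induction n generalizing q with
  | zero => simpa [wordTo, start_zero] using hR.refl _
  | succ n ih =>
    have hl := (F.tree n).numLeaves_pos
    have h1 := hR.append (hR.move_treeWord (F.tree n) (p := n) (q := q) (by omega))
      (hR.refl (F.wordTo n))
    have h2 := hR.append (hR.refl (treeWord (F.tree n) n))
      (ih (q := q + (F.tree n).numLeaves - 1) (by omega))
    have hs := F.le_start n
    have e : q + (F.tree n).numLeaves - 1 + F.start n - n =
      q + (F.start n + (F.tree n).numLeaves) - (n + 1) := by omega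
    rw [e] at h2
    simp only [wordTo, start_succ, List.cons_append, List.nil_append, List.append_assoc]
      at h1 h2 ⊢
    exact hR.trans h1 h2

theorem IsWordCongruence.treeWord_graft (hR : IsWordCongruence R) (t : BTree) {k p : ℕ}
    (h : k < t.numLeaves) (g : ℕ → BTree)
    (hg : ∀ j, g j = if j = k then .node () .nil .nil else .nil) :
    R (treeWord (t.graft g) p) (treeWord t p ++ [p + k]) := by
  induction t generalizing k p g with
  | nil =>
    simp only [BinaryTree.numLeaves, Nat.lt_one_iff] at h
    subst h
    simpa [BTree.graft, hg, treeWord] using hR.refl _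
  | node a l r ihl ihr =>
    simp only [BinaryTree.numLeaves] at h
    simp only [BTree.graft, treeWord, List.cons_append, List.append_assoc]
    have hl := l.numLeaves_pos
    by_cases hk : k < l.numLeaves
    · rw [BTree.graft_nil r _ fun j _ => by rw [hg, if_neg (by omega)]]
      have h1 := hR.append (hR.refl (p :: treeWord r (p + 1))) (ihl (p := p) hk g hg)
      simpa using h1
    · rw [BTree.graft_nil l _ fun j _ => by rw [hg, if_neg (by omega)]]
      have h1 := ihr (k := k - l.numLeaves) (p := p + 1) (by omega) (fun j => g (l.numLeaves + j))
        (fun j => by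
          rw [hg]
          by_cases hj : j = k - l.numLeaves
          · rw [if_pos hj, if_pos (by omega)]
          · rw [if_neg hj, if_neg (by omega)])
      have h2 := hR.append (hR.append (hR.refl [p]) h1) (hR.refl (treeWord l p))
      have h3 := hR.append (hR.refl (p :: treeWord r (p + 1)))
        (hR.move_treeWord l (p := p) (q := p + 1 + (k - l.numLeaves)) (by omega))
      have e : p + 1 + (k - l.numLeaves) + l.numLeaves - 1 = p + k := by omega
      rw [e] at h3
      simp only [List.cons_append, List.nil_append, List.append_assoc] at h2 h3
      exact hR.trans h2 h3

theorem IsWordCongruence.wordTo_mul_lam (hR : IsWordCongruence R) (F : Forest) (i n : ℕ) :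
    R ((F * lam i).wordTo n) (F.wordTo n ++ if i < F.start n then [i] else []) := by
  induction n with
  | zero => simpa [wordTo, start_zero] using hR.refl _
  | succ n ih =>
    have hl := (F.tree n).numLeaves_pos
    simp only [wordTo, start_succ, mul_tree, lam_tree]
    by_cases h1 : i < F.start n
    · rw [BTree.graft_nil _ _ fun j _ => if_neg (by omega), if_pos (by omega)]
      rw [if_pos h1] at ih
      simpa using hR.append (hR.refl (treeWord (F.tree n) n)) ih
    · rw [if_neg h1, List.append_nil] at ih
      by_cases h2 : i < F.start n + (F.tree n).numLeaves
      · rw [if_pos h2]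
        have h3 := hR.treeWord_graft (F.tree n) (k := i - F.start n) (p := n) (by omega)
          (fun j => if F.start n + j = i then .node () .nil .nil else .nil)
          (fun j => by
            by_cases hj : j = i - F.start n
            · rw [if_pos hj, if_pos (by omega)]
            · rw [if_neg hj, if_neg (by omega)])
        have h4 := hR.append h3 ih
        have h5 := hR.append (hR.refl (treeWord (F.tree n) n))
          (hR.move_wordTo F (n := n) (q := n + (i - F.start n)) (by omega))
        have e : n + (i - F.start n) + F.start n - n = i := by omega
        rw [e] at h5
        simp only [List.cons_append, List.nil_append, List.append_assoc] at h4 h5 ⊢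
        exact hR.trans h4 h5
      · rw [if_neg h2, BTree.graft_nil _ _ fun j _ => if_neg (by omega)]
        simpa using hR.append (hR.refl (treeWord (F.tree n) n)) ih

theorem IsWordCongruence.word_mul_lam (hR : IsWordCongruence R) (F : Forest) (i : ℕ) :
    R (F * lam i).word (F.word ++ [i]) := by
  obtain ⟨N, hN⟩ := F.exists_bound
  obtain ⟨M, hM⟩ := (F * lam i).exists_bound
  have h := hR.wordTo_mul_lam F i (max (max N M) (i + 1))
  have hs := F.le_start (max (max N M) (i + 1))
  rw [if_pos (by omega), ← word_eq F fun j hj => hN j (by omega),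
    ← word_eq (F * lam i) fun j hj => hM j (by omega)] at h
  exact h

/-- Two words representing the same forest are congruent. -/
theorem IsWordCongruence.word_ofWord (hR : IsWordCongruence R) (w : List ℕ) :
    R (ofWord w).word w := by
  induction w using List.reverseRecOn with
  | nil => rw [ofWord_nil, word_one]; exact hR.refl _
  | append_singleton w i ih =>
    have h := hR.word_mul_lam (ofWord w) i
    rw [ofWord_append, show ofWord [i] = lam i by simp [ofWord]]
    exact hR.trans h (hR.append ih (hR.refl _))

end Congruence

end Forest

/-! ## The infinite braid group -/

/-- The relators of the infinite braid group on generators `σ_0, σ_1, …`. -/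
def braidRels : Set (FreeGroup ℕ) :=
  {r | ∃ m n : ℕ, m + 2 ≤ n ∧
    r = (FreeGroup.of m * FreeGroup.of n) * (FreeGroup.of n * FreeGroup.of m)⁻¹} ∪
  {r | ∃ m : ℕ, r = (FreeGroup.of m * FreeGroup.of (m + 1) * FreeGroup.of m) *
    (FreeGroup.of (m + 1) * FreeGroup.of m * FreeGroup.of (m + 1))⁻¹}

/-- The infinite braid group `B_∞`: generators `σ_m`, `m ≥ 0`, and relations
`σ_m σ_n = σ_n σ_m` for `|m - n| ≥ 2` and `σ_m σ_(m+1) σ_m = σ_(m+1) σ_m σ_(m+1)`. -/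
abbrev BraidInf : Type := PresentedGroup braidRels

namespace BraidInf

/-- The generator `σ_m`. -/
def gen (m : ℕ) : BraidInf := PresentedGroup.of m

theorem gen_comm {m n : ℕ} (h : m + 2 ≤ n) : gen m * gen n = gen n * gen m :=
  mul_inv_eq_one.1 (PresentedGroup.one_of_mem (rels := braidRels) (Or.inl ⟨m, n, h, rfl⟩))

theorem gen_braid (m : ℕ) :
    gen m * gen (m + 1) * gen m = gen (m + 1) * gen m * gen (m + 1) :=
  mul_inv_eq_one.1 (PresentedGroup.one_of_mem (rels := braidRels) (Or.inr ⟨m, rfl⟩))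

/-- A map on generators that respects the braid relations extends to `B_∞`. -/
def lift {G : Type*} [Group G] (f : ℕ → G) (hc : ∀ m n, m + 2 ≤ n → f m * f n = f n * f m)
    (hb : ∀ m, f m * f (m + 1) * f m = f (m + 1) * f m * f (m + 1)) : BraidInf →* G :=
  PresentedGroup.toGroup (f := f) (by
    rintro r (⟨m, n, h, rfl⟩ | ⟨m, rfl⟩)
    · simp only [map_mul, map_inv, FreeGroup.lift_apply_of]
      rw [mul_inv_eq_one]
      exact hc m n h
    · simp only [map_mul, map_inv, FreeGroup.lift_apply_of]
      rw [mul_inv_eq_one]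
      exact hb m)

theorem lift_gen {G : Type*} [Group G] (f : ℕ → G) (hc hb) (m : ℕ) :
    lift f hc hb (gen m) = f m := PresentedGroup.toGroup.of _

@[elab_as_elim]
theorem induction {P : BraidInf → Prop} (one : P 1) (gen_mul : ∀ m σ, P σ → P (gen m * σ))
    (inv_mul : ∀ m σ, P σ → P ((gen m)⁻¹ * σ)) (σ : BraidInf) : P σ := by
  have h : σ ∈ Subgroup.closure (Set.range gen) := by
    rw [show Set.range gen = Set.range (PresentedGroup.of (rels := braidRels)) from rfl,
      PresentedGroup.closure_range_of]
    trivial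
  induction h using Subgroup.closure_induction_left with
  | one => exact one
  | mul_left x hx y _ ih => obtain ⟨m, rfl⟩ := hx; exact gen_mul m y ih
  | inv_mul_cancel x hx y _ ih => obtain ⟨m, rfl⟩ := hx; exact inv_mul m y ih

/-- The permutation `j ↦ σ(j)` underlying a braid; `σ_m` goes to the transposition of
`m` and `m + 1`. -/
def perm : BraidInf →* Equiv.Perm ℕ :=
  lift (fun m => Equiv.swap m (m + 1))
    (fun m n h => by
      ext k
      simp only [Equiv.Perm.mul_apply, Equiv.swap_apply_def]
      split_ifs <;> omega)
    (fun m => by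
      ext k
      simp only [Equiv.Perm.mul_apply, Equiv.swap_apply_def]
      split_ifs <;> omega)

theorem perm_gen (m : ℕ) : perm (gen m) = Equiv.swap m (m + 1) := lift_gen _ _ _ _

/-- The braid `σ_q ^ λ_m` obtained from `σ_q` by splitting a strand. -/
def splitGen (q m : ℕ) : BraidInf :=
  if m < q then gen (q + 1)
  else if m = q then gen q * gen (q + 1)
  else if m = q + 1 then gen (q + 1) * gen q
  else gen q

/-- The permutation `(m, β) ↦ (σ_q(m), σ_q ^ λ_m * β)` of `ℕ × B_∞`. -/
def splitPerm (q : ℕ) : Equiv.Perm (ℕ × BraidInf) where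
  toFun x := (Equiv.swap q (q + 1) x.1, splitGen q x.1 * x.2)
  invFun x := (Equiv.swap q (q + 1) x.1, (splitGen q (Equiv.swap q (q + 1) x.1))⁻¹ * x.2)
  left_inv x := by simp
  right_inv x := by simp

theorem splitPerm_apply (q m : ℕ) (β : BraidInf) :
    splitPerm q (m, β) = (Equiv.swap q (q + 1) m, splitGen q m * β) := rfl

theorem splitPerm_lt {q m : ℕ} (h : m < q) (β : BraidInf) :
    splitPerm q (m, β) = (m, gen (q + 1) * β) := by
  rw [splitPerm_apply, Equiv.swap_apply_of_ne_of_ne (by omega) (by omega), splitGen, if_pos h]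

theorem splitPerm_left (q : ℕ) (β : BraidInf) :
    splitPerm q (q, β) = (q + 1, gen q * (gen (q + 1) * β)) := by
  rw [splitPerm_apply, Equiv.swap_apply_left, splitGen, if_neg (by omega), if_pos rfl, mul_assoc]

theorem splitPerm_right (q : ℕ) (β : BraidInf) :
    splitPerm q (q + 1, β) = (q, gen (q + 1) * (gen q * β)) := by
  rw [splitPerm_apply, Equiv.swap_apply_right, splitGen, if_neg (by omega), if_neg (by omega),
    if_pos rfl, mul_assoc]

theorem splitPerm_gt {q m : ℕ} (h : q + 1 < m) (β : BraidInf) :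
    splitPerm q (m, β) = (m, gen q * β) := by
  rw [splitPerm_apply, Equiv.swap_apply_of_ne_of_ne (by omega) (by omega), splitGen,
    if_neg (by omega), if_neg (by omega), if_neg (by omega)]

theorem gen_comm_assoc {m n : ℕ} (h : m + 2 ≤ n) (β : BraidInf) :
    gen n * (gen m * β) = gen m * (gen n * β) := by
  rw [← mul_assoc, ← gen_comm h, mul_assoc]

theorem gen_braid_assoc (m : ℕ) (β : BraidInf) :
    gen (m + 1) * (gen m * (gen (m + 1) * β)) = gen m * (gen (m + 1) * (gen m * β)) := by
  simp only [← mul_assoc, gen_braid]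

theorem splitPerm_comm (m n : ℕ) (h : m + 2 ≤ n) :
    splitPerm m * splitPerm n = splitPerm n * splitPerm m := by
  ext1 ⟨k, β⟩
  simp only [Equiv.Perm.mul_apply]
  have c (i j : ℕ) (h : i + 2 ≤ j) (β : BraidInf) := gen_comm_assoc h β
  rcases (by omega : k < m ∨ k = m ∨ k = m + 1 ∨ (m + 1 < k ∧ k < n) ∨ k = n ∨ k = n + 1 ∨
    n + 1 < k) with hk | rfl | rfl | ⟨hk, hk'⟩ | rfl | rfl | hk
  · have h1 : k < n := by omega
    simp only [splitPerm_lt hk, splitPerm_lt h1]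
    rw [c (m + 1) (n + 1) (by omega)]
  · have h1 : k < n := by omega
    have h2 : k + 1 < n := by omega
    simp only [splitPerm_left, splitPerm_lt h1, splitPerm_lt h2]
    rw [c k (n + 1) (by omega), c (k + 1) (n + 1) (by omega)]
  · have h1 : m < n := by omega
    have h2 : m + 1 < n := by omega
    simp only [splitPerm_right, splitPerm_lt h1, splitPerm_lt h2]
    rw [c (m + 1) (n + 1) (by omega), c m (n + 1) (by omega)]
  · simp only [splitPerm_gt hk, splitPerm_lt hk']
    rw [c m (n + 1) (by omega)]
  · have h1 : m + 1 < k := by omega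
    have h2 : m + 1 < k + 1 := by omega
    simp only [splitPerm_left, splitPerm_gt h1, splitPerm_gt h2]
    rw [c m (k + 1) (by omega), c m k (by omega)]
  · have h1 : m + 1 < n := by omega
    have h2 : m + 1 < n + 1 := by omega
    simp only [splitPerm_right, splitPerm_gt h1, splitPerm_gt h2]
    rw [c m n (by omega), c m (n + 1) (by omega)]
  · have h1 : m + 1 < k := by omega
    simp only [splitPerm_gt hk, splitPerm_gt h1]
    rw [c m n (by omega)]

theorem splitPerm_braid (m : ℕ) :
    splitPerm m * splitPerm (m + 1) * splitPerm m =
      splitPerm (m + 1) * splitPerm m * splitPerm (m + 1) := by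
  ext1 ⟨k, β⟩
  simp only [Equiv.Perm.mul_apply]
  have c (β : BraidInf) : gen (m + 1 + 1) * (gen m * β) = gen m * (gen (m + 1 + 1) * β) :=
    gen_comm_assoc (by omega) β
  have b1 := gen_braid_assoc m
  have b2 := gen_braid_assoc (m + 1)
  rcases (by omega : k < m ∨ k = m ∨ k = m + 1 ∨ k = m + 1 + 1 ∨ m + 1 + 1 < k) with
    hk | rfl | rfl | rfl | hk
  · have hk' : k < m + 1 := by omega
    simp only [splitPerm_lt hk, splitPerm_lt hk', b2]
  · have h1 : k < k + 1 := by omega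
    have h2 : k + 1 < k + 1 + 1 := by omega
    simp only [splitPerm_left, splitPerm_gt h2, splitPerm_lt h1]
    rw [c, ← b1, ← b2, c]
  · have h1 : m < m + 1 := by omega
    have h2 : m + 1 < m + 1 + 1 := by omega
    simp only [splitPerm_left, splitPerm_right, splitPerm_gt h2, splitPerm_lt h1]
    rw [b1, c, ← c β, b2]
  · have h1 : m < m + 1 := by omega
    have h2 : m + 1 < m + 1 + 1 := by omega
    simp only [splitPerm_right, splitPerm_gt h2, splitPerm_lt h1]
    rw [← c (gen (m + 1) * β), b2, b1, c]
  · have hk' : m + 1 < k := by omega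
    simp only [splitPerm_gt hk, splitPerm_gt hk', b1]

/-- The action of `B_∞` on `ℕ × B_∞` given on generators by `splitPerm`. -/
def splitHom : BraidInf →* Equiv.Perm (ℕ × BraidInf) :=
  lift splitPerm splitPerm_comm splitPerm_braid

/-- The braid `σ ^ λ_m` obtained from `σ` by splitting the strand with bottom at `m` into two
parallel strands. It is determined by its values `splitGen` on the generators and the rule
`(σ τ) ^ λ_m = σ ^ λ_(τ(m)) * τ ^ λ_m` (see `split_gen`, `split_inv_gen`, `split_mul`). -/
def split (σ : BraidInf) (m : ℕ) : BraidInf := (splitHom σ (m, 1)).2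

theorem splitHom_gen (m : ℕ) : splitHom (gen m) = splitPerm m := lift_gen _ _ _ _

theorem splitHom_apply (σ : BraidInf) (m : ℕ) (β : BraidInf) :
    splitHom σ (m, β) = (perm σ m, split σ m * β) := by
  have h2 : ∀ m x, (splitPerm m)⁻¹ x = (Equiv.swap m (m + 1) x.1,
      (splitGen m (Equiv.swap m (m + 1) x.1))⁻¹ * x.2) := fun _ _ => rfl
  have h1 : ∀ m x, splitPerm m x = (Equiv.swap m (m + 1) x.1, splitGen m x.1 * x.2) :=
    fun _ _ => rfl
  have key (σ : BraidInf) : (∀ x : ℕ × BraidInf, (splitHom σ x).1 = perm σ x.1) ∧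
      ∀ (x : ℕ × BraidInf) (γ : BraidInf),
        (splitHom σ (x.1, x.2 * γ)).2 = (splitHom σ x).2 * γ := by
    induction σ using induction with
    | one => simp
    | gen_mul m σ ih =>
      constructor
      · intro x
        simp only [map_mul, Equiv.Perm.mul_apply, splitHom_gen, h1, perm_gen, ih.1]
      · intro x γ
        simp only [map_mul, Equiv.Perm.mul_apply, splitHom_gen, h1, ih.1, ih.2, mul_assoc]
    | inv_mul m σ ih =>
      constructor
      · intro x
        simp only [map_mul, map_inv, Equiv.Perm.mul_apply, splitHom_gen, h2, perm_gen, ih.1,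
          Equiv.swap_inv]
      · intro x γ
        simp only [map_mul, map_inv, Equiv.Perm.mul_apply, splitHom_gen, h2, ih.1, ih.2, mul_assoc]
  ext1
  · exact (key σ).1 _
  · simpa [split] using (key σ).2 (m, 1) β

theorem split_one (m : ℕ) : split 1 m = 1 := by simp [split]

theorem split_mul (σ τ : BraidInf) (m : ℕ) :
    split (σ * τ) m = split σ (perm τ m) * split τ m := by
  have h : splitHom (σ * τ) (m, 1) = splitHom σ (splitHom τ (m, 1)) := by
    rw [map_mul, Equiv.Perm.mul_apply]
  rw [splitHom_apply, splitHom_apply, splitHom_apply] at h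
  simpa using congrArg Prod.snd h

theorem split_gen (q m : ℕ) : split (gen q) m =
    if m < q then gen (q + 1)
    else if m = q then gen q * gen (q + 1)
    else if m = q + 1 then gen (q + 1) * gen q
    else gen q := by
  rw [split, splitHom_gen, splitPerm_apply, mul_one]; rfl

theorem split_inv_gen (q m : ℕ) : split (gen q)⁻¹ m =
    if m < q then (gen (q + 1))⁻¹
    else if m = q then (gen q)⁻¹ * (gen (q + 1))⁻¹
    else if m = q + 1 then (gen (q + 1))⁻¹ * (gen q)⁻¹
    else (gen q)⁻¹ := by
  have h := split_mul (gen q) (gen q)⁻¹ m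
  rw [mul_inv_cancel, split_one, eq_comm, mul_eq_one_iff_inv_eq, map_inv, perm_gen,
    Equiv.swap_inv, split_gen] at h
  rw [← h]
  rcases (by omega : m < q ∨ m = q ∨ m = q + 1 ∨ q + 1 < m) with hk | rfl | rfl | hk
  · rw [Equiv.swap_apply_of_ne_of_ne (by omega) (by omega), if_pos hk, if_pos hk]
  · rw [Equiv.swap_apply_left]; simp
  · rw [Equiv.swap_apply_right]; simp
  · rw [Equiv.swap_apply_of_ne_of_ne (by omega) (by omega)]
    simp [show ¬ m < q by omega, show ¬ m = q by omega, show ¬ m = q + 1 by omega]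

/-- The compatibility of splitting two different strands. -/
def SplitCompat (σ : BraidInf) : Prop :=
  ∀ m q : ℕ, m < q → perm (split σ q) m = (if perm σ m < perm σ q then perm σ m
      else perm σ m + 1) ∧
    perm (split σ m) (q + 1) = (if perm σ m < perm σ q then perm σ q + 1 else perm σ q) ∧
    split (split σ q) m = split (split σ m) (q + 1)

theorem SplitCompat.mul {σ τ : BraidInf} (hσ : SplitCompat σ) (hτ : SplitCompat τ) :
    SplitCompat (σ * τ) := by
  intro m q h
  obtain ⟨h1, h2, h3⟩ := hτ m q h
  simp only [split_mul, map_mul, Equiv.Perm.mul_apply, h1, h2, h3]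
  by_cases hlt : perm τ m < perm τ q
  · obtain ⟨k1, k2, k3⟩ := hσ _ _ hlt
    simp only [if_pos hlt, k1, k2, k3, and_self]
  · have hne : perm τ m ≠ perm τ q := fun e => h.ne ((perm τ).injective e)
    have hne' : perm σ (perm τ m) ≠ perm σ (perm τ q) := fun e => hne ((perm σ).injective e)
    obtain ⟨k1, k2, k3⟩ := hσ (perm τ q) (perm τ m) (by omega)
    simp only [if_neg hlt, k1, k2, k3, and_true]
    constructor <;> split_ifs <;> omega

theorem splitCompat_of (s : ℕ → BraidInf) (hp : ∀ q, perm (s q) = Equiv.swap q (q + 1))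
    (hs : ∀ q m, split (s q) m = if m < q then s (q + 1) else if m = q then s q * s (q + 1)
      else if m = q + 1 then s (q + 1) * s q else s q)
    (hc : ∀ q, s (q + 1 + 1) * s q = s q * s (q + 1 + 1)) (i : ℕ) : SplitCompat (s i) := by
  intro m q h
  rcases (by omega : (m < i ∧ q < i) ∨ (m < i ∧ q = i) ∨ (m < i ∧ q = i + 1) ∨
    (m < i ∧ i + 1 < q) ∨ (m = i ∧ q = i + 1) ∨ (m = i ∧ i + 1 < q) ∨ (m = i + 1 ∧ i + 1 < q) ∨
    i + 1 < m) with ⟨h1, h2⟩ | ⟨h1, rfl⟩ | ⟨h1, rfl⟩ | ⟨h1, h2⟩ | ⟨rfl, rfl⟩ | ⟨rfl, h2⟩ |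
    ⟨rfl, h2⟩ | h1 <;>
  refine ⟨?_, ?_, ?_⟩ <;>
  simp (disch := omega) only [hs, hp, split_mul, map_mul, Equiv.Perm.mul_apply,
    Equiv.swap_apply_def, if_pos, if_neg, if_true, mul_assoc]
  rw [← mul_assoc (s (m + 1 + 1)), hc, mul_assoc]

theorem splitCompat (σ : BraidInf) : SplitCompat σ := by
  induction σ using induction with
  | one => intro m q h; simp [split_one, h]
  | gen_mul m σ ih =>
    exact (splitCompat_of gen perm_gen split_gen (fun q => (gen_comm (by omega)).symm) m).mul ih
  | inv_mul m σ ih =>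
    refine (splitCompat_of (fun q => (gen q)⁻¹) (fun q => ?_) split_inv_gen (fun q => ?_) m).mul ih
    · rw [map_inv, perm_gen, Equiv.swap_inv]
    · rw [← mul_inv_rev, ← mul_inv_rev, gen_comm (by omega)]

end BraidInf

/-! ## The mutual actions of forests and braids -/

namespace BraidInf

/-- `σ ^ w` for a word `w` in the generators `λ_i` of the monoid of forests. -/
def powWord : BraidInf → List ℕ → BraidInf
  | σ, [] => σ
  | σ, i :: w => powWord (split σ i) w

/-- `σ · w` for a word `w` in the generators `λ_i` of the monoid of forests: `σ` takes `λ_i w` to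
`λ_(σ(i)) (σ ^ λ_i · w)`. -/
def dotWord : BraidInf → List ℕ → List ℕ
  | _, [] => []
  | σ, i :: w => perm σ i :: dotWord (split σ i) w

theorem powWord_append (σ : BraidInf) (v w : List ℕ) :
    powWord σ (v ++ w) = powWord (powWord σ v) w := by
  induction v generalizing σ with
  | nil => rfl
  | cons i v ih => exact ih _

theorem dotWord_append (σ : BraidInf) (v w : List ℕ) :
    dotWord σ (v ++ w) = dotWord σ v ++ dotWord (powWord σ v) w := by
  induction v generalizing σ with
  | nil => rfl
  | cons i v ih => simp [dotWord, powWord, ih]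

theorem dotWord_mul (σ τ : BraidInf) (w : List ℕ) :
    dotWord (σ * τ) w = dotWord σ (dotWord τ w) := by
  induction w generalizing σ τ with
  | nil => rfl
  | cons i w ih => simp only [dotWord, split_mul, ih, map_mul, Equiv.Perm.mul_apply]

theorem powWord_mul (σ τ : BraidInf) (w : List ℕ) :
    powWord (σ * τ) w = powWord σ (dotWord τ w) * powWord τ w := by
  induction w generalizing σ τ with
  | nil => rfl
  | cons i w ih => simp only [dotWord, powWord, split_mul, ih]

theorem dotWord_one (w : List ℕ) : dotWord 1 w = w := by
  induction w with
  | nil => rfl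
  | cons i w ih => simp [dotWord, split_one, ih]

theorem powWord_one (w : List ℕ) : powWord 1 w = 1 := by
  induction w with
  | nil => rfl
  | cons i w ih => simp [powWord, split_one, ih]

/-- The results of `σ ^ w` and `σ · w` depend only on the forest represented by `w`. -/
theorem isWordCongruence : Forest.IsWordCongruence fun v w =>
    ∀ σ : BraidInf, powWord σ v = powWord σ w ∧
      Forest.ofWord (dotWord σ v) = Forest.ofWord (dotWord σ w) where
  refl _ _ := ⟨rfl, rfl⟩
  symm h σ := ⟨(h σ).1.symm, (h σ).2.symm⟩
  trans h k σ := ⟨(h σ).1.trans (k σ).1, (h σ).2.trans (k σ).2⟩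
  append h k σ := by
    simp only [powWord_append, dotWord_append, Forest.ofWord_append, (h σ).1, (h σ).2,
      (k _).1, (k _).2, and_self]
  rel {m q} h σ := by
    obtain ⟨h1, h2, h3⟩ := splitCompat σ m q h
    refine ⟨h3, ?_⟩
    have hne : perm σ m ≠ perm σ q := fun e => h.ne ((perm σ).injective e)
    simp only [dotWord, Forest.ofWord_cons, Forest.ofWord_nil, mul_one, h1, h2]
    split_ifs with hlt
    · exact Forest.lam_mul_lam hlt
    · exact (Forest.lam_mul_lam (by omega)).symm

theorem powWord_congr {v w : List ℕ} (h : Forest.ofWord v = Forest.ofWord w) (σ : BraidInf) :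
    powWord σ v = powWord σ w := by
  rw [← (isWordCongruence.word_ofWord v σ).1, h, (isWordCongruence.word_ofWord w σ).1]

theorem dotWord_congr {v w : List ℕ} (h : Forest.ofWord v = Forest.ofWord w) (σ : BraidInf) :
    Forest.ofWord (dotWord σ v) = Forest.ofWord (dotWord σ w) := by
  rw [← (isWordCongruence.word_ofWord v σ).2, h, (isWordCongruence.word_ofWord w σ).2]

/-- The mutual actions `(σ, F) ↦ σ ^ F` and `(σ, F) ↦ σ · F` of the monoid of forests and the
infinite braid group that define their Zappa-Szép product. They are the extensions, by the laws of
mutual actions, of the values on generators given in `forestActions_dot_gen`,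
`forestActions_dot_inv_gen`, `forestActions_pow_gen`, `forestActions_pow_inv_gen`. -/
noncomputable def forestActions : ZappaSzepActions Forest BraidInf where
  pow σ F := powWord σ F.word
  dot σ F := Forest.ofWord (dotWord σ F.word)
  mul_dot σ τ F := by
    rw [dotWord_mul]
    exact (dotWord_congr (Forest.ofWord_word _) σ).symm
  mul_pow σ τ F := by
    rw [powWord_mul, ← powWord_congr (Forest.ofWord_word _) σ]
  dot_mul σ F G := by
    rw [← Forest.ofWord_append, ← dotWord_append]
    exact dotWord_congr (by simp only [Forest.ofWord_append, Forest.ofWord_word]) σ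
  pow_mul σ F G := by
    rw [← powWord_append]
    exact powWord_congr (by simp only [Forest.ofWord_append, Forest.ofWord_word]) σ
  pow_one σ := by rw [Forest.word_one]; rfl
  one_dot F := by rw [dotWord_one, Forest.ofWord_word]
  dot_one σ := by rw [Forest.word_one]; rfl
  one_pow F := powWord_one _

theorem ofWord_word_lam (m : ℕ) :
    Forest.ofWord (Forest.lam m).word = Forest.ofWord [m] := by
  rw [Forest.ofWord_word]; simp [Forest.ofWord]

theorem forestActions_pow_lam (σ : BraidInf) (m : ℕ) :
    forestActions.pow σ (Forest.lam m) = split σ m :=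
  powWord_congr (ofWord_word_lam m) σ

theorem forestActions_dot_lam (σ : BraidInf) (m : ℕ) :
    forestActions.dot σ (Forest.lam m) = Forest.lam (perm σ m) := by
  refine (dotWord_congr (ofWord_word_lam m) σ).trans ?_
  simp [dotWord, Forest.ofWord]

theorem forestActions_dot_gen (q m : ℕ) :
    forestActions.dot (gen q) (Forest.lam m) = Forest.lam (Equiv.swap q (q + 1) m) := by
  rw [forestActions_dot_lam, perm_gen]

theorem forestActions_dot_inv_gen (q m : ℕ) :
    forestActions.dot (gen q)⁻¹ (Forest.lam m) = Forest.lam (Equiv.swap q (q + 1) m) := by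
  rw [forestActions_dot_lam, map_inv, perm_gen, Equiv.swap_inv]

theorem forestActions_pow_gen (q m : ℕ) :
    forestActions.pow (gen q) (Forest.lam m) =
      if m < q then gen (q + 1)
      else if m = q then gen q * gen (q + 1)
      else if m = q + 1 then gen (q + 1) * gen q
      else gen q := by
  rw [forestActions_pow_lam, split_gen]

theorem forestActions_pow_inv_gen (q m : ℕ) :
    forestActions.pow (gen q)⁻¹ (Forest.lam m) =
      if m < q then (gen (q + 1))⁻¹
      else if m = q then (gen q)⁻¹ * (gen (q + 1))⁻¹
      else if m = q + 1 then (gen (q + 1))⁻¹ * (gen q)⁻¹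
      else (gen q)⁻¹ := by
  rw [forestActions_pow_lam, split_inv_gen]

end BraidInf

/-! ## Cancellation and common left multiples in the monoid of forests -/

namespace Forest

-- The action of `λ_m` on a braid doubles the strand with bottom at `m`. Deleting the left half of
-- the doubled strand undoes this, so every map `σ ↦ σ ^ λ_m` has a left inverse. A general `σ ↦ σ ^
-- u` is a composite of such maps, hence injective (`delete_split`, `powWord_injective`).
--
-- For coconfluence, take first `σ ^ λ_m = τ ^ λ_n` with `m < n`. If `n = m + 1`, a common left
-- multiple would have a leaf that is both a right child and a left child. If `m + 1 < n`, let `β`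
-- be `τ` with strand `m` deleted. Deletion and splitting of different strands commute up to
-- renumbering, which yields `σ = β ^ λ_(n-1)`; injectivity then yields `τ = β ^ λ_m`
-- (`exists_of_split_eq`). On the forest side, every common left multiple factors through `λ_(n-1)
-- λ_m = λ_m λ_n` (`exists_of_mul_lam_eq`).
--
-- These squares are pasted together by induction on word length (`exists_of_powWord_eq`). Each
-- smaller problem also needs a common left multiple, so the induction carries the given multiple `a
-- u = b v` along and factors it through the square found. The facts about forests come from a
-- faithful invariant, the sequence of addresses of the leaves.

/-- The effect on the sequence of addresses of the leaves of hanging a caret from leaf `m`; the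
address of a leaf lists the turns on the path from the leaf to its root. -/
def hang (x : ℕ → List Bool) (m k : ℕ) : List Bool :=
  if k < m then x k else if k = m then false :: x m else if k = m + 1 then true :: x m
  else x (k - 1)

/-- The addresses of the leaves of the forest spelled by a word. -/
def addr (w : List ℕ) : ℕ → List Bool := w.foldl hang fun _ => []

theorem addr_append_singleton (w : List ℕ) (m : ℕ) : addr (w ++ [m]) = hang (addr w) m := by
  simp [addr]

theorem hang_hang (x : ℕ → List Bool) {m q : ℕ} (h : m < q) :
    hang (hang x q) m = hang (hang x m) (q + 1) := by
  funext k
  rcases (by omega : k < m ∨ k = m ∨ k = m + 1 ∨ (m + 1 < k ∧ k < q + 1) ∨ k = q + 1 ∨ k = q + 2 ∨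
    q + 2 < k) with hk | rfl | rfl | ⟨h1, h2⟩ | rfl | rfl | hk <;>
  simp (disch := omega) [hang, if_pos, if_neg]

/-- Nothing is lost by hanging a caret: an old leaf `k` keeps its address at position `k` or `k +
1`, and the address of leaf `m` is the tail of its new entry. -/
theorem hang_injective {x y : ℕ → List Bool} {m : ℕ} (h : hang x m = hang y m) : x = y := by
  funext k
  rcases lt_trichotomy k m with hk | rfl | hk
  · simpa [hang, hk] using congrFun h k
  · simpa [hang] using congrFun h k
  · simpa (disch := omega) [hang, if_neg] using congrFun h (k + 1)

/-- This makes addresses an invariant of the forest rather than of the word; `hang_hang` supplies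
the only nontrivial condition. -/
theorem isWordCongruence_foldl_hang :
    IsWordCongruence fun v w => ∀ x, v.foldl hang x = w.foldl hang x where
  refl _ _ := rfl
  symm h x := (h x).symm
  trans h k x := (h x).trans (k x)
  append h k x := by simp only [List.foldl_append, h x, k]
  rel h x := hang_hang x h

theorem addr_congr {v w : List ℕ} (h : ofWord v = ofWord w) : addr v = addr w := by
  have hv := isWordCongruence_foldl_hang.word_ofWord v fun _ => []
  rw [h] at hv
  exact hv.symm.trans (isWordCongruence_foldl_hang.word_ofWord w _)

theorem ofWord_append_singleton (w : List ℕ) (m : ℕ) : ofWord (w ++ [m]) = ofWord w * lam m := by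
  simp [ofWord]

/-- If the leaves `k` and `k + 1` are a left child and a right child, they are the leaves of
a caret. -/
theorem exists_eq_mul_lam (w : List ℕ) {k : ℕ} (h0 : (addr w k).head? = some false)
    (h1 : (addr w (k + 1)).head? = some true) :
    ∃ c : List ℕ, ofWord w = ofWord (c ++ [k]) := by
  induction w using List.reverseRecOn generalizing k with
  | nil => simp [addr] at h0
  | append_singleton w j ih =>
    rw [addr_append_singleton] at h0 h1
    rcases (by omega : j = k ∨ k + 1 < j ∨ j = k + 1 ∨ j + 1 = k ∨ j + 1 < k) with
      rfl | hj | rfl | rfl | hj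
    · exact ⟨w, rfl⟩
    · simp (disch := omega) only [hang, if_pos] at h0 h1
      obtain ⟨c, e⟩ := ih h0 h1
      -- The last caret lies to the right of both leaves. Moving it before the caret at `k` removes
      -- the shift by one that this caret had caused.
      refine ⟨c ++ [j - 1], ?_⟩
      obtain ⟨j, rfl⟩ : ∃ i, j = i + 1 := ⟨j - 1, by omega⟩
      simp only [ofWord_append_singleton, e, mul_assoc, Nat.add_sub_cancel]
      rw [lam_mul_lam (m := k) (q := j) (by omega)]
    -- In this case and the next, the last caret would make leaf `k + 1` a left child, or leaf `k` a
    -- right child.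
    · simp [hang] at h1
    · simp [hang] at h0
    · obtain ⟨k, rfl⟩ : ∃ i, k = i + 1 := ⟨k - 1, by omega⟩
      simp (disch := omega) only [hang, if_neg, Nat.add_sub_cancel] at h0 h1
      obtain ⟨c, e⟩ := ih h0 h1
      refine ⟨c ++ [j], ?_⟩
      simp only [ofWord_append_singleton, e, mul_assoc]
      rw [lam_mul_lam (by omega)]

/-- A forest is determined by the addresses of its leaves. -/
theorem ofWord_eq_of_addr_eq (v w : List ℕ) (h : addr v = addr w) : ofWord v = ofWord w := by
  induction v using List.reverseRecOn generalizing w with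
  | nil =>
    rcases w.eq_nil_or_concat' with rfl | ⟨w, j, rfl⟩
    · rfl
    · have := congrFun h j
      rw [addr_append_singleton] at this
      simp [addr, hang] at this
  | append_singleton v j ih =>
    -- The final caret of the first word is visible in the common addresses, so it can be split off
    -- the second word too.
    obtain ⟨c, e⟩ := exists_eq_mul_lam w (k := j)
      (by rw [← h, addr_append_singleton]; simp [hang])
      (by rw [← h, addr_append_singleton]; simp [hang])
    rw [addr_congr e, addr_append_singleton, addr_append_singleton] at h
    rw [e, ofWord_append_singleton, ofWord_append_singleton, ih c (hang_injective h)]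

/-- Addresses determine the forest, and the effect of a caret on addresses is injective. -/
theorem mul_lam_cancel {a b : Forest} {m : ℕ} (h : a * lam m = b * lam m) : a = b := by
  rw [← ofWord_word a, ← ofWord_word b] at h ⊢
  rw [← ofWord_append_singleton, ← ofWord_append_singleton] at h
  have h' := addr_congr h
  rw [addr_append_singleton, addr_append_singleton] at h'
  exact ofWord_eq_of_addr_eq _ _ (hang_injective h')

/-- The common left multiples of `λ_m` and `λ_n`, where `m < n`, are the left multiples of
`λ_(n-1) λ_m = λ_m λ_n`, and exist only if `m + 1 < n`. -/
theorem exists_of_mul_lam_eq {a b : Forest} {m n : ℕ} (hmn : m < n)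
    (h : a * lam m = b * lam n) :
    m + 1 < n ∧ ∃ c, a = c * lam (n - 1) ∧ b = c * lam m := by
  have h' : ofWord (a.word ++ [m]) = ofWord (b.word ++ [n]) := by
    simpa only [ofWord_append_singleton, ofWord_word] using h
  have e := addr_congr h'
  rw [addr_append_singleton, addr_append_singleton] at e
  have hlt : m + 1 < n := by
    by_contra hn
    obtain rfl : n = m + 1 := by omega
    -- Leaf `m + 1` would be the right child of one caret and the left child of the other.
    simpa [hang] using congrFun e (m + 1)
  obtain ⟨n, rfl⟩ : ∃ i, n = i + 1 := ⟨n - 1, by omega⟩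
  -- The caret of `λ_(n+1)` occupies leaves `n + 1` and `n + 2` of the common multiple. The caret at
  -- `m` lies entirely to their left, so they come from leaves `n` and `n + 1` of `a`, which must
  -- then form a caret of `a`.
  have e0 := congrFun e (n + 1)
  have e1 := congrFun e (n + 1 + 1)
  simp (disch := omega) [hang, if_neg] at e0 e1
  obtain ⟨c, hc⟩ := exists_eq_mul_lam a.word (k := n)
    (by grind) (by grind)
  rw [ofWord_word, ofWord_append_singleton] at hc
  refine ⟨hlt, ofWord c, hc, mul_lam_cancel (m := n + 1) ?_⟩
  rw [← h, hc, mul_assoc, lam_mul_lam (by omega), mul_assoc]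

end Forest

/-! ## Deletion of a strand -/

namespace BraidInf

/-- The braid obtained from `σ_q` by deleting the strand with bottom at `m`. -/
def deleteGen (q m : ℕ) : BraidInf :=
  if m < q then gen (q - 1) else if m = q then 1 else if m = q + 1 then 1 else gen q

/-- The permutation `(m, β) ↦ (σ_q(m), β' β)` of `ℕ × B_∞`, where `β'` is obtained from `σ_q` by
deleting the strand with bottom at `m`. -/
def deletePerm (q : ℕ) : Equiv.Perm (ℕ × BraidInf) where
  toFun x := (Equiv.swap q (q + 1) x.1, deleteGen q x.1 * x.2)
  invFun x := (Equiv.swap q (q + 1) x.1, (deleteGen q (Equiv.swap q (q + 1) x.1))⁻¹ * x.2)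
  left_inv x := by simp
  right_inv x := by simp

theorem deletePerm_apply (q m : ℕ) (β : BraidInf) :
    deletePerm q (m, β) = (Equiv.swap q (q + 1) m, deleteGen q m * β) := rfl

/-- The index is written `q + 1` so that the predecessor in `deleteGen` is exact. -/
theorem deletePerm_lt {q m : ℕ} (h : m < q + 1) (β : BraidInf) :
    deletePerm (q + 1) (m, β) = (m, gen q * β) := by
  rw [deletePerm_apply, Equiv.swap_apply_of_ne_of_ne (by omega) (by omega), deleteGen, if_pos h,
    Nat.add_sub_cancel]

theorem deletePerm_left (q : ℕ) (β : BraidInf) : deletePerm q (q, β) = (q + 1, β) := by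
  simp [deletePerm_apply, deleteGen]

theorem deletePerm_right (q : ℕ) (β : BraidInf) : deletePerm q (q + 1, β) = (q, β) := by
  simp [deletePerm_apply, deleteGen]

theorem deletePerm_gt {q m : ℕ} (h : q + 1 < m) (β : BraidInf) :
    deletePerm q (m, β) = (m, gen q * β) := by
  rw [deletePerm_apply, Equiv.swap_apply_of_ne_of_ne (by omega) (by omega), deleteGen,
    if_neg (by omega), if_neg (by omega), if_neg (by omega)]

theorem deletePerm_comm (m n : ℕ) (h : m + 2 ≤ n) :
    deletePerm m * deletePerm n = deletePerm n * deletePerm m := by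
  ext1 ⟨k, β⟩
  obtain ⟨n, rfl⟩ : ∃ i, n = i + 1 := ⟨n - 1, by omega⟩
  simp only [Equiv.Perm.mul_apply]
  rcases (by omega : k < m ∨ k = m ∨ k = m + 1 ∨ (m + 1 < k ∧ k < n + 1) ∨ k = n + 1 ∨
    k = n + 1 + 1 ∨ n + 1 + 1 < k) with hk | rfl | rfl | ⟨hk, hk'⟩ | rfl | rfl | hk
  · obtain ⟨m, rfl⟩ : ∃ i, m = i + 1 := ⟨m - 1, by omega⟩
    simp (disch := omega) only [deletePerm_lt]
    rw [gen_comm_assoc (m := m) (n := n) (by omega)]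
  · simp (disch := omega) only [deletePerm_left, deletePerm_lt]
  · simp (disch := omega) only [deletePerm_right, deletePerm_lt]
  · simp (disch := omega) only [deletePerm_gt, deletePerm_lt]
    -- Deletion lowers only the second index, but having a strand strictly between the two crossings
    -- keeps the indices at distance at least two.
    rw [gen_comm_assoc (m := m) (n := n) (by omega)]
  · simp (disch := omega) only [deletePerm_left, deletePerm_gt]
  · simp (disch := omega) only [deletePerm_right, deletePerm_gt]
  · simp (disch := omega) only [deletePerm_gt]
    rw [gen_comm_assoc (m := m) (n := n + 1) (by omega)]

/-- If the deleted strand is one of the three involved, both sides reduce to the one crossing of the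
other two; otherwise a braid relation remains. -/
theorem deletePerm_braid (m : ℕ) :
    deletePerm m * deletePerm (m + 1) * deletePerm m =
      deletePerm (m + 1) * deletePerm m * deletePerm (m + 1) := by
  ext1 ⟨k, β⟩
  simp only [Equiv.Perm.mul_apply]
  rcases (by omega : k < m ∨ k = m ∨ k = m + 1 ∨ k = m + 1 + 1 ∨ m + 1 + 1 < k) with
    hk | rfl | rfl | rfl | hk
  · obtain ⟨m, rfl⟩ : ∃ i, m = i + 1 := ⟨m - 1, by omega⟩
    simp (disch := omega) only [deletePerm_lt, gen_braid_assoc]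
  · simp (disch := omega) only [deletePerm_left, deletePerm_lt, deletePerm_gt]
  · simp (disch := omega) only [deletePerm_left, deletePerm_right, deletePerm_lt, deletePerm_gt]
  · simp (disch := omega) only [deletePerm_right, deletePerm_lt, deletePerm_gt]
  · simp (disch := omega) only [deletePerm_gt, gen_braid_assoc]

/-- The action of `B_∞` on `ℕ × B_∞` given on generators by `deletePerm`. -/
def deleteHom : BraidInf →* Equiv.Perm (ℕ × BraidInf) :=
  lift deletePerm deletePerm_comm deletePerm_braid

/-- The braid obtained from `σ` by deleting the strand with bottom at `m`. -/
def delete (σ : BraidInf) (m : ℕ) : BraidInf := (deleteHom σ (m, 1)).2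

theorem deleteHom_gen (m : ℕ) : deleteHom (gen m) = deletePerm m := lift_gen _ _ _ _

/-- The action covers the permutation action on `ℕ` and commutes with right multiplication on `B_∞`,
so its values at `(m, 1)` determine it. -/
theorem deleteHom_apply (σ : BraidInf) (m : ℕ) (β : BraidInf) :
    deleteHom σ (m, β) = (perm σ m, delete σ m * β) := by
  have h2 : ∀ m x, (deletePerm m)⁻¹ x = (Equiv.swap m (m + 1) x.1,
      (deleteGen m (Equiv.swap m (m + 1) x.1))⁻¹ * x.2) := fun _ _ => rfl
  have h1 : ∀ m x, deletePerm m x = (Equiv.swap m (m + 1) x.1, deleteGen m x.1 * x.2) :=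
    fun _ _ => rfl
  -- The two properties are proved together: equivariance of the second coordinate uses the formula
  -- for the first.
  have key (σ : BraidInf) : (∀ x : ℕ × BraidInf, (deleteHom σ x).1 = perm σ x.1) ∧
      ∀ (x : ℕ × BraidInf) (γ : BraidInf),
        (deleteHom σ (x.1, x.2 * γ)).2 = (deleteHom σ x).2 * γ := by
    induction σ using induction with
    | one => simp
    | gen_mul m σ ih =>
      constructor
      · intro x
        simp only [map_mul, Equiv.Perm.mul_apply, deleteHom_gen, h1, perm_gen, ih.1]
      · intro x γ
        simp only [map_mul, Equiv.Perm.mul_apply, deleteHom_gen, h1, ih.1, ih.2, mul_assoc]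
    | inv_mul m σ ih =>
      constructor
      · intro x
        simp only [map_mul, map_inv, Equiv.Perm.mul_apply, deleteHom_gen, h2, perm_gen, ih.1,
          Equiv.swap_inv]
      · intro x γ
        simp only [map_mul, map_inv, Equiv.Perm.mul_apply, deleteHom_gen, h2, ih.1, ih.2,
          mul_assoc]
  ext1
  · exact (key σ).1 _
  · simpa [delete] using (key σ).2 (m, 1) β

theorem delete_one (m : ℕ) : delete 1 m = 1 := by simp [delete]

theorem delete_mul (σ τ : BraidInf) (m : ℕ) :
    delete (σ * τ) m = delete σ (perm τ m) * delete τ m := by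
  have h : deleteHom (σ * τ) (m, 1) = deleteHom σ (deleteHom τ (m, 1)) := by
    rw [map_mul, Equiv.Perm.mul_apply]
  rw [deleteHom_apply, deleteHom_apply, deleteHom_apply] at h
  simpa using congrArg Prod.snd h

theorem delete_gen (q m : ℕ) : delete (gen q) m =
    if m < q then gen (q - 1) else if m = q then 1 else if m = q + 1 then 1 else gen q := by
  rw [delete, deleteHom_gen, deletePerm_apply, mul_one]; rfl

theorem delete_inv_gen (q m : ℕ) : delete (gen q)⁻¹ m =
    if m < q then (gen (q - 1))⁻¹ else if m = q then 1 else if m = q + 1 then 1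
    else (gen q)⁻¹ := by
  have h := delete_mul (gen q) (gen q)⁻¹ m
  rw [mul_inv_cancel, delete_one, eq_comm, mul_eq_one_iff_inv_eq, map_inv, perm_gen,
    Equiv.swap_inv, delete_gen] at h
  rw [← h]
  rcases (by omega : m < q ∨ m = q ∨ m = q + 1 ∨ q + 1 < m) with hk | rfl | rfl | hk
  · rw [Equiv.swap_apply_of_ne_of_ne (by omega) (by omega), if_pos hk, if_pos hk]
  · rw [Equiv.swap_apply_left]; simp
  · rw [Equiv.swap_apply_right]; simp
  · rw [Equiv.swap_apply_of_ne_of_ne (by omega) (by omega)]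
    simp [show ¬ m < q by omega, show ¬ m = q by omega, show ¬ m = q + 1 by omega]

-- Interaction of deletion with splitting

/-- Deleting a half of a split strand recovers the braid. -/
def DeleteSplitSelf (σ : BraidInf) : Prop :=
  ∀ m, perm (split σ m) m = perm σ m ∧ delete (split σ m) m = σ

/-- The compatibility of splitting strand `n` and deleting another strand `m`. -/
def DeleteSplitCompat (σ : BraidInf) : Prop :=
  ∀ m n, m ≠ n →
    perm (split σ n) (if m < n then m else m + 1) =
      (if perm σ m < perm σ n then perm σ m else perm σ m + 1) ∧
    perm (delete σ m) (if n < m then n else n - 1) =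
      (if perm σ n < perm σ m then perm σ n else perm σ n - 1) ∧
    delete (split σ n) (if m < n then m else m + 1) =
      split (delete σ m) (if n < m then n else n - 1)

/-- The permutation clause is what lets the cocycle rules compose: it says which strand of the split
left factor is to be deleted. -/
theorem DeleteSplitSelf.mul {σ τ : BraidInf} (hσ : DeleteSplitSelf σ) (hτ : DeleteSplitSelf τ) :
    DeleteSplitSelf (σ * τ) := by
  intro m
  simp only [split_mul, delete_mul, map_mul, Equiv.Perm.mul_apply, (hτ m).1, (hτ m).2,
    (hσ (perm τ m)).1, (hσ (perm τ m)).2, and_self]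

/-- The two permutation clauses track the renumbered strands through the right factor. The
subtraction `n - 1` is genuine, since it occurs only when `m < n`. -/
theorem DeleteSplitCompat.mul {σ τ : BraidInf} (hσ : DeleteSplitCompat σ)
    (hτ : DeleteSplitCompat τ) : DeleteSplitCompat (σ * τ) := by
  intro m n h
  obtain ⟨h1, h2, h3⟩ := hτ m n h
  obtain ⟨k1, k2, k3⟩ := hσ (perm τ m) (perm τ n) fun e => h ((perm τ).injective e)
  simp only [split_mul, delete_mul, map_mul, Equiv.Perm.mul_apply, h1, h2, h3, k1, k2, k3, and_self]

/-- Stated for an abstract sequence `s` so that one computation serves both the generators and their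
inverses. -/
theorem deleteSplitSelf_of (s : ℕ → BraidInf) (hp : ∀ q, perm (s q) = Equiv.swap q (q + 1))
    (hs : ∀ q m, split (s q) m = if m < q then s (q + 1) else if m = q then s q * s (q + 1)
      else if m = q + 1 then s (q + 1) * s q else s q)
    (hd : ∀ q m, delete (s q) m = if m < q then s (q - 1) else if m = q then 1
      else if m = q + 1 then 1 else s q) (i : ℕ) : DeleteSplitSelf (s i) := by
  intro m
  rcases (by omega : m < i ∨ m = i ∨ m = i + 1 ∨ i + 1 < m) with h | rfl | rfl | h <;>
  refine ⟨?_, ?_⟩ <;>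
  simp (disch := omega) [hs, hp, hd, delete_mul, Equiv.swap_apply_def, if_pos, if_neg]

theorem deleteSplitCompat_of (s : ℕ → BraidInf) (hp : ∀ q, perm (s q) = Equiv.swap q (q + 1))
    (hs : ∀ q m, split (s q) m = if m < q then s (q + 1) else if m = q then s q * s (q + 1)
      else if m = q + 1 then s (q + 1) * s q else s q)
    (hd : ∀ q m, delete (s q) m = if m < q then s (q - 1) else if m = q then 1
      else if m = q + 1 then 1 else s q) (i : ℕ) : DeleteSplitCompat (s i) := by
  intro m n h
  rcases lt_or_gt_of_ne h with h | h <;>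
  rcases (by omega : m < i ∨ i = m ∨ i + 1 = m ∨ i + 1 < m) with h1 | rfl | rfl | h1 <;>
  rcases (by omega : n < i ∨ i = n ∨ i + 1 = n ∨ i + 1 < n) with h2 | rfl | rfl | h2 <;>
  first
  | omega
  -- Separating `i = 0` lets the index `i - 1` produced by deletion simplify.
  | cases i <;> first
    | omega
    | refine ⟨?_, ?_, ?_⟩ <;>
      simp (disch := omega) only [hs, hp, hd, delete_mul, split_one, map_mul, map_one,
        Equiv.Perm.mul_apply, Equiv.Perm.one_apply, Equiv.swap_apply_def, if_pos, if_neg, if_true,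
        mul_one, Nat.add_sub_cancel]

theorem deleteSplitSelf (σ : BraidInf) : DeleteSplitSelf σ := by
  induction σ using induction with
  | one => intro m; simp [split_one, delete_one]
  | gen_mul m σ ih => exact (deleteSplitSelf_of gen perm_gen split_gen delete_gen m).mul ih
  | inv_mul m σ ih =>
    refine (deleteSplitSelf_of (fun q => (gen q)⁻¹) (fun q => ?_) split_inv_gen
      delete_inv_gen m).mul ih
    rw [map_inv, perm_gen, Equiv.swap_inv]

theorem deleteSplitCompat (σ : BraidInf) : DeleteSplitCompat σ := by
  induction σ using induction with
  | one => intro m n h; simp [split_one, delete_one]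
  | gen_mul m σ ih => exact (deleteSplitCompat_of gen perm_gen split_gen delete_gen m).mul ih
  | inv_mul m σ ih =>
    refine (deleteSplitCompat_of (fun q => (gen q)⁻¹) (fun q => ?_) split_inv_gen
      delete_inv_gen m).mul ih
    rw [map_inv, perm_gen, Equiv.swap_inv]

/-! ## Strong coconfluence -/

theorem delete_split (σ : BraidInf) (m : ℕ) : delete (split σ m) m = σ := (deleteSplitSelf σ m).2

theorem split_injective (m : ℕ) : Function.Injective (split · m) :=
  Function.LeftInverse.injective (g := (delete · m)) fun σ => delete_split σ m

theorem powWord_injective (w : List ℕ) : Function.Injective (powWord · w) := by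
  induction w with
  | nil => exact fun _ _ h => h
  | cons i w ih => exact ih.comp (split_injective i)

theorem exists_of_split_eq {σ τ : BraidInf} {m n : ℕ} (hmn : m + 1 < n)
    (h : split σ m = split τ n) :
    ∃ β, σ = split β (n - 1) ∧ τ = split β m := by
  have hσ : σ = split (delete τ m) (n - 1) := by
    -- Delete strand `m` from both sides of `h`: the left gives `σ`, and on the right the deletion
    -- passes the splitting of `n`, now numbered `n - 1`.
    have h' := (deleteSplitCompat τ m n (by omega)).2.2
    rwa [if_pos (by omega), if_neg (by omega), ← h, delete_split] at h'
  refine ⟨delete τ m, hσ, split_injective n ?_⟩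
  -- Splitting the strands of `β` in either order gives the same braid, so `β ^ λ_m` and `τ` agree
  -- after splitting strand `n`.
  have h' := (splitCompat (delete τ m) m (n - 1) (by omega)).2.2
  rw [← hσ, h, Nat.sub_add_cancel (by omega)] at h'
  exact h'

open Forest in
-- Squares for single carets are pasted together. The length bounds make the second inductive call
-- legitimate, and the common factor `d` of `a` and `b` supplies the common left multiple it
-- requires.
theorem exists_of_powWord_eq (u v : List ℕ) (σ τ : BraidInf) (h : powWord σ u = powWord τ v)
    (a b : Forest) (hab : a * ofWord u = b * ofWord v) :
    ∃ (γ : BraidInf) (p q : List ℕ) (d : Forest), σ = powWord γ p ∧ τ = powWord γ q ∧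
      ofWord (p ++ u) = ofWord (q ++ v) ∧ a = d * ofWord p ∧ b = d * ofWord q ∧
      p.length ≤ v.length ∧ q.length ≤ u.length := by
  induction hN : u.length + v.length using Nat.strong_induction_on generalizing u v σ τ a b with
  | _ N ih =>
  rcases u.eq_nil_or_concat' with rfl | ⟨u, m, rfl⟩
  · exact ⟨τ, v, [], b, h, rfl, by simp, by simpa [ofWord_nil] using hab, by simp [ofWord_nil],
      le_rfl, le_rfl⟩
  rcases v.eq_nil_or_concat' with rfl | ⟨v, n, rfl⟩
  · exact ⟨σ, [], u ++ [m], a, rfl, h.symm, by simp, by simp [ofWord_nil],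
      by simpa [ofWord_nil] using hab.symm, le_rfl, le_rfl⟩
  -- The claim is symmetric under exchanging the two sides.
  wlog hmn : m ≤ n generalizing u v m n σ τ a b
  · obtain ⟨γ, p, q, d, h1, h2, h3, h4, h5, h6, h7⟩ :=
      this τ σ b a v n u m h.symm hab.symm (by rw [← hN]; simp; omega) (by omega)
    exact ⟨γ, q, p, d, h2, h1, h3.symm, h5, h4, h7, h6⟩
  simp only [List.length_append, List.length_singleton] at hN ⊢
  simp only [powWord_append, ofWord_append_singleton, ← mul_assoc] at h hab
  rcases hmn.eq_or_lt with rfl | hlt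
  · obtain ⟨γ, p, q, d, h1, h2, h3, h4, h5, h6, h7⟩ :=
      ih _ (by omega) u v σ τ (split_injective m h) a b (mul_lam_cancel hab) rfl
    refine ⟨γ, p, q, d, h1, h2, ?_, h4, h5, by omega, by omega⟩
    rw [← List.append_assoc, ofWord_append, h3, ← ofWord_append, List.append_assoc]
  -- The square on the last letters, once for forests and once for braids, with corner `β` and
  -- multiplier `c`.
  obtain ⟨hlt, c, hc, hc'⟩ := exists_of_mul_lam_eq hlt hab
  obtain ⟨β, hβ, hβ'⟩ := exists_of_split_eq hlt h
  -- First complete `u` against the single letter `n - 1`; then complete `q` followed by `m` against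
  -- `v`. The bound on `q` by `u` makes the second problem smaller than the original one.
  obtain ⟨γ, p, q, d, h1, h2, h3, h4, h5, h6, h7⟩ :=
    ih _ (by simp; omega) u [n - 1] σ β hβ a c (by simpa [ofWord] using hc) rfl
  simp only [List.length_singleton] at h6
  obtain ⟨γ', p', q', d', k1, k2, k3, k4, k5, k6, k7⟩ :=
    ih _ (by simp; omega) (q ++ [m]) v γ τ (by rw [powWord_append, ← h2, hβ']; rfl) d b
      (by rw [ofWord_append_singleton, ← mul_assoc, ← h5, hc']) rfl
  simp only [List.length_append, List.length_singleton] at k7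
  refine ⟨γ', p' ++ p, q', d', by rw [powWord_append, ← k1, h1], k2, ?_,
    by rw [h4, k4, ofWord_append, mul_assoc], k5, by simp; omega, by omega⟩
  have hl := lam_mul_lam (m := m) (q := n - 1) (by omega)
  rw [Nat.sub_add_cancel (by omega)] at hl
  simp only [ofWord_append, ofWord_cons, ofWord_nil, mul_one] at h3 k3 ⊢
  calc _ = ofWord p' * (ofWord p * ofWord u) * lam m := by simp only [mul_assoc]
    _ = ofWord p' * ofWord q * (lam (n - 1) * lam m) := by rw [h3]; simp only [mul_assoc]
    _ = ofWord p' * (ofWord q * lam m) * lam n := by rw [hl]; simp only [mul_assoc]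
    _ = _ := by rw [k3]; simp only [mul_assoc]

theorem forestActions_pow_ofWord (σ : BraidInf) (w : List ℕ) :
    forestActions.pow σ (Forest.ofWord w) = powWord σ w :=
  powWord_congr (Forest.ofWord_word _) σ

end BraidInf

/-- The family of functions `σ ↦ σ ^ u` of the infinite braid group to itself, indexed by the
forests `u`, is a strongly coconfluent family of injections. -/
theorem lemma4p13 :
    IsInjectiveFamily BraidInf.forestActions.pow ∧
      IsStronglyCoconfluent BraidInf.forestActions.pow := by
  refine ⟨fun u _ _ h => BraidInf.powWord_injective u.word h,
    BraidInf.forestActions.pow_mul, ?_⟩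
  rintro σ τ u v h ⟨a, b, hab⟩
  rw [← u.ofWord_word, ← v.ofWord_word] at hab
  -- Here `h` is used as an equation of `powWord` on the chosen words, to which it unfolds by
  -- definition.
  obtain ⟨γ, p, q, d, h1, h2, h3, -⟩ :=
    BraidInf.exists_of_powWord_eq u.word v.word σ τ h a b hab
  refine ⟨γ, Forest.ofWord p, Forest.ofWord q, ?_, ?_, ?_⟩
  · rw [BraidInf.forestActions_pow_ofWord, h1]
  · rw [BraidInf.forestActions_pow_ofWord, h2]
  · rwa [Forest.ofWord_append, Forest.ofWord_append, u.ofWord_word, v.ofWord_word] at h3
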